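/- **Theorem B.** Let $m,n\ge 1$ be integers, let $A\in\mathbb{R}^{m\times n}$, and let $\epsilon=(\epsilon_1,\ldots,\epsilon_{\min\{m,n\}})$ with all $\epsilon_r\in\{1,-1\}$; put $\epsilon_0:=1$. For $\mathbf{x}\in\mathbb{R}^N$ let $S^-(\mathbf{x})$ be the number of sign changes in the sequence $x_1,\ldots,x_N$ after discarding all zero entries, with $S^-(\mathbf{0}):=0$. For $\mathbf{x}\neq\mathbf{0}$ let $S^+(\mathbf{x})$ be the maximum number of sign changes in the sequences obtained from $\mathbf{x}$ by allocating to each zero entry a value $1$ or $-1$; put $S^+(\mathbf{0}):=N$ for $\mathbf{0}\in\mathbb{R}^N$. For $\mathbf{y}\ne\mathbf{0}$, the *completed sign* of a first (last) component of $\mathbf{y}$ is its sign if it is nonzero, and otherwise the (unique) sign it receives in any allocation attaining $S^+(\mathbf{y})$. A contiguous submatrix is one whose rows and columns are indexed by consecutive integers, and $\mathrm{adj}$ denotes the adjugate (equal to $1$ for a $1\times1$ matrix). The matrix $A$ is SSR$(\epsilon)$ if for every $1\le r\le\min\{m,n\}$ all $r\times r$ minors of $A$ are nonzero with sign $\epsilon_r$.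 For each contiguous square submatrix $A_k$ of $A$, of size $k\times k$ with $1\le k\le\min\{m,n\}$, fix an arbitrary nonzero vector $\mathbf{v}=\mathbf{v}^{A_k}\in\mathbb{R}^k$ in the alternating bi-orthant, i.e. $\mathbf{v}=\pm(\alpha_1,-\alpha_2,\ldots,(-1)^{k-1}\alpha_k)^T$ with all $\alpha_j\ge0$, and define $\mathbf{x}^{A_k}:=\mathrm{adj}(A_k)\mathbf{v}$. Then the following are equivalent. 1. $A$ is SSR$(\epsilon)$. 2. For all $\mathbf{0}\ne\mathbf{x}\in\mathbb{R}^n$ we have $S^+(A\mathbf{x})\le S^-(\mathbf{x})$. Further, for all $\mathbf{x}\in\mathbb{R}^n$ with $A\mathbf{x}\neq\mathbf{0}$ and $S^+(A\mathbf{x})=S^-(\mathbf{x})=r$, where $0\le r\le\min\{m,n\}-1$, the completed sign of the first (respectively, last) component of $A\mathbf{x}$ equals $\epsilon_r\epsilon_{r+1}$ times the sign of the first (respectively, last) nonzero component of $\mathbf{x}$. 3. For every contiguous square submatrix $A_k$ of $A$, of size $k\times k$ with $1\le k\le\min\{m,n\}$, we have $S^+(A_k\mathbf{x}^{A_k})\le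 S^-(\mathbf{x}^{A_k})$. Moreover, if $S^+(A_k\mathbf{x}^{A_k})=S^-(\mathbf{x}^{A_k})=r$ with $0\le r\le k-1$, then the completed sign of the first (respectively, last) component of $A_k\mathbf{x}^{A_k}$ equals $\epsilon_r\epsilon_{r+1}$ times the sign of the first (respectively, last) nonzero component of $\mathbf{x}^{A_k}$. -/

import Mathlib

noncomputable section

namespace SignRegular

/-- Number of sign changes in a sequence of signs after discarding its zero entries: each sign
change is recorded as the pair of positions `p.1 < p.2` of two successive nonzero entries
(everything strictly in between is zero) that have opposite signs. -/
def signChanges {n : ℕ} (s : Fin n → SignType) : ℕ :=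
  (Finset.univ.filter fun p : Fin n × Fin n =>
    p.1 < p.2 ∧ s p.1 * s p.2 = -1 ∧ ∀ l, p.1 < l → l < p.2 → s l = 0).card

/-- `S⁻(x)`. In particular `S⁻(0) = 0`. -/
def sMinus {n : ℕ} (x : Fin n → ℝ) : ℕ :=
  signChanges fun i => SignType.sign (x i)

/-- `s` is obtained from the signs of `x` by allocating to each zero entry a value `1` or `-1`. -/
def IsFilling {n : ℕ} (x : Fin n → ℝ) (s : Fin n → SignType) : Prop :=
  (∀ i, s i ≠ 0) ∧ ∀ i, x i ≠ 0 → s i = SignType.sign (x i)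

open Classical in
/-- `S⁺(x)`: the maximal number of sign changes over all fillings, with `S⁺(0) = n` on `ℝⁿ`. -/
def sPlus {n : ℕ} (x : Fin n → ℝ) : ℕ :=
  if x = 0 then n
  else (Finset.univ.filter fun s : Fin n → SignType => IsFilling x s).sup signChanges

/-- A filling that realizes `S⁺(x)`, for `x ≠ 0`. The first and the last entry do not depend on
the choice of the maximal filling, as leading and trailing zeros must be filled alternatingly. -/
def IsMaxFilling {n : ℕ} (x : Fin n → ℝ) (s : Fin n → SignType) : Prop :=
  IsFilling x s ∧ signChanges s = sPlus x

/-- `x p` is the first nonzero component of `x`. -/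
def IsFirstNonzero {n : ℕ} (x : Fin n → ℝ) (p : Fin n) : Prop :=
  x p ≠ 0 ∧ ∀ l, l < p → x l = 0

/-- `x p` is the last nonzero component of `x`. -/
def IsLastNonzero {n : ℕ} (x : Fin n → ℝ) (p : Fin n) : Prop :=
  x p ≠ 0 ∧ ∀ l, p < l → x l = 0

/-- The sign of the first (last) component of `y` (if zero, the sign given in determining
`S⁺(y)`) agrees with `η` times the sign of the first (last) nonzero component of `x`. A component
of `y` that is nonzero has its own sign in every filling. -/
def EndSignsAgree {m n : ℕ} (η : SignType) (y : Fin m → ℝ) (x : Fin n → ℝ) : Prop :=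
  ∀ s, IsMaxFilling y s →
    (∀ (i : Fin m) (p : Fin n), (i : ℕ) = 0 → IsFirstNonzero x p →
      s i = η * SignType.sign (x p)) ∧
    (∀ (i : Fin m) (p : Fin n), (i : ℕ) + 1 = m → IsLastNonzero x p →
      s i = η * SignType.sign (x p))

/-- `ε_r` for a tuple `ε = (ε_1, …, ε_k)`, stored with indices shifted by one; `ε_0 = 1`.
(The value `1` for `r > k` is never used.) -/
def signAt {k : ℕ} (ε : Fin k → SignType) (r : ℕ) : SignType :=
  if h : 1 ≤ r ∧ r ≤ k then ε ⟨r - 1, by omega⟩ else 1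

/-- `A` is SSR(ε): every `r × r` minor of `A` has sign `ε_r`, for `1 ≤ r ≤ min {m, n}`. -/
def IsSSR {m n : ℕ} (A : Matrix (Fin m) (Fin n) ℝ) (ε : Fin (min m n) → SignType) : Prop :=
  ∀ r, 1 ≤ r → r ≤ min m n → ∀ (I : Fin r ↪o Fin m) (J : Fin r ↪o Fin n),
    SignType.sign (A.submatrix I J).det = signAt ε r

/-- The variation diminishing property for all vectors, with the sign condition at the ends. -/
def VariationDiminishing {m n : ℕ} (A : Matrix (Fin m) (Fin n) ℝ)
    (ε : Fin (min m n) → SignType) : Prop :=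
  (∀ x : Fin n → ℝ, x ≠ 0 → sPlus (A.mulVec x) ≤ sMinus x) ∧
  ∀ (x : Fin n → ℝ) (r : ℕ), A.mulVec x ≠ 0 →
    sPlus (A.mulVec x) = r → sMinus x = r → r < min m n →
      EndSignsAgree (signAt ε r * signAt ε (r + 1)) (A.mulVec x) x

/-- The contiguous `k × k` submatrix of `A` in rows `a, …, a + k - 1` and columns
`b, …, b + k - 1` (counted from `0`). -/
def contiguous {m n : ℕ} (A : Matrix (Fin m) (Fin n) ℝ) (k a b : ℕ)
    (ha : a + k ≤ m) (hb : b + k ≤ n) : Matrix (Fin k) (Fin k) ℝ :=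
  A.submatrix (fun i => ⟨a + i, by omega⟩) (fun j => ⟨b + j, by omega⟩)

/-- Nonzero vectors of the alternating bi-orthant: `±(α_1, -α_2, …, (-1)^(k-1) α_k)` with all
`α_j ≥ 0`, not all zero. -/
def InAlternatingBiorthant {k : ℕ} (v : Fin k → ℝ) : Prop :=
  v ≠ 0 ∧ ((∀ j : Fin k, 0 ≤ (-1) ^ (j : ℕ) * v j) ∨
    ∀ j : Fin k, (-1) ^ (j : ℕ) * v j ≤ 0)

/-- The variation diminishing property with the sign condition at the ends, only for the single
test vector `adj(A_k) v` of each contiguous square submatrix `A_k`; here `v k a b` is the vector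
chosen for the `k × k` submatrix whose first row and column have index `a` and `b`. -/
def TestVectorCondition {m n : ℕ} (A : Matrix (Fin m) (Fin n) ℝ)
    (ε : Fin (min m n) → SignType) (v : (k : ℕ) → ℕ → ℕ → Fin k → ℝ) : Prop :=
  ∀ (k a b : ℕ) (ha : a + k ≤ m) (hb : b + k ≤ n), 1 ≤ k →
    let B := contiguous A k a b ha hb
    let x := B.adjugate.mulVec (v k a b)
    sPlus (B.mulVec x) ≤ sMinus x ∧
    ∀ r : ℕ, sPlus (B.mulVec x) = r → sMinus x = r → r < k →
      EndSignsAgree (signAt ε r * signAt ε (r + 1)) (B.mulVec x) x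

end SignRegular

end

namespace SignRegular

/-! The engine is Cramer's rule without cancellation. If the minors of a square matrix that avoid
its first column share a sign, the first row of its adjugate has alternating signs, so pairing it
with a weakly alternating nonzero vector adds terms of one sign (`sign_adjugate_mulVec_zero`).

From minors to variation (`variationDiminishing_of_minors`): grouping the entries of `x` into its
`S⁻(x) + 1` sign blocks replaces `A` by a matrix with that many columns, whose relevant minors keep
their signs by multilinearity (`sign_det_mul_of_blocks`). One alternation too many in `A x` would
contradict the vanishing of a bordered determinant. In the case of equality, Cramer's rule in the
first component yields the signs at the ends.

Back to minors, by induction on the order: for a submatrix `B` of order `k + 1` and an alternating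
vector `w`, the vector `x = adj(B) w` satisfies `B x = det(B) w`. Counting signs forces `S⁺ = S⁻ =
k`, and the end condition then reads off the sign of `det B`. This works for any `B` if all vectors
may be tested (`VariationDiminishing.sign_det`). With test vectors it reaches only contiguous `B`,
and a three-term determinantal identity spreads the sign to all minors (`sign_det_of_contiguous`).
-/

theorem sign_mul_self_of_ne_zero {a : SignType} (h : a ≠ 0) : a * a = 1 := by
  revert h; revert a; decide

theorem neg_one_pow_signType_ne_zero (k : ℕ) : (-1 : SignType) ^ k ≠ 0 :=
  pow_ne_zero _ (by decide)

/-! ### Combinatorics of sign changes, `S⁻` and `S⁺`. -/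

/-- A nonzero sign sequence splits into consecutive blocks, numbered by the number of sign
changes that precede them, on which the nonzero signs are constant. -/
theorem exists_blocks {n : ℕ} (s : Fin n → SignType) (h : ∃ i, s i ≠ 0) :
    ∃ (b : Fin n → ℕ) (σ : SignType), σ ≠ 0 ∧ Monotone b ∧ (∀ i, b i ≤ signChanges s) ∧
      (∀ i, s i ≠ 0 → s i = σ * (-1) ^ b i) ∧
      ∀ k ≤ signChanges s, ∃ i, s i ≠ 0 ∧ b i = k := by
  classical
  -- `T` holds the right ends of the sign changes. A right end determines its left end, the
  -- preceding nonzero position, so `T` has as many elements as there are changes.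
  set T : Finset (Fin n) := Finset.univ.filter fun q =>
    ∃ p < q, s p * s q = -1 ∧ ∀ l, p < l → l < q → s l = 0 with hT
  have hTmem : ∀ q, q ∈ T ↔ ∃ p < q, s p * s q = -1 ∧ ∀ l, p < l → l < q → s l = 0 := by
    simp [hT]
  have hTne : ∀ q ∈ T, s q ≠ 0 := by
    intro q hq h0
    obtain ⟨p, -, hp, -⟩ := (hTmem q).1 hq
    simp [h0] at hp
  have hcard : T.card = signChanges s := by
    unfold signChanges
    rw [← Finset.card_image_of_injOn (f := Prod.snd)]
    · congr 1
      ext q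
      simp [hTmem]
    · rintro ⟨p, q⟩ hp ⟨p', q'⟩ hp' hqq
      simp only [Finset.coe_filter, Finset.mem_univ, true_and, Set.mem_ofPred_eq] at hp hp' hqq
      subst hqq
      obtain ⟨h1, h2, h3⟩ := hp
      obtain ⟨h1', h2', h3'⟩ := hp'
      rcases lt_trichotomy p p' with hlt | heq | hgt
      · simp [h3 p' hlt h1'] at h2'
      · rw [heq]
      · simp [h3' p hgt h1] at h2
  obtain ⟨f, hf0, hfmin⟩ : ∃ f, s f ≠ 0 ∧ ∀ l, l < f → s l = 0 := by
    have hne : (Finset.univ.filter fun i => s i ≠ 0).Nonempty := by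
      obtain ⟨i, hi⟩ := h
      exact ⟨i, by simpa using hi⟩
    refine ⟨_, by simpa using Finset.min'_mem _ hne, fun l hl => ?_⟩
    by_contra hl0
    exact absurd (Finset.min'_le _ l (by simpa using hl0)) (not_le.2 hl)
  -- The block number of `i` counts the sign changes completed at or before `i`; a zero entry joins
  -- the block on its left.
  set c : Fin n → ℕ := fun i => (T.filter (· ≤ i)).card with hc
  have hcmono : Monotone c := fun i j hij =>
    Finset.card_le_card fun q hq => by
      rw [Finset.mem_filter] at hq ⊢
      exact ⟨hq.1, hq.2.trans hij⟩
  have hcf : c f = 0 := by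
    rw [hc, Finset.card_eq_zero, Finset.filter_eq_empty_iff]
    intro q hq hqf
    obtain ⟨p, hpq, hp, -⟩ := (hTmem q).1 hq
    simp [hfmin p (hpq.trans_le hqf)] at hp
  refine ⟨c, s f, hf0, hcmono, fun i => hcard ▸ Finset.card_filter_le _ _, ?_, ?_⟩
  · intro i
    induction i using WellFoundedLT.induction with
    | ind i ih =>
      intro hi
      by_cases hex : ∃ p < i, s p ≠ 0
      · have hne : (Finset.univ.filter fun p => p < i ∧ s p ≠ 0).Nonempty := by
          obtain ⟨p, hp⟩ := hex
          exact ⟨p, by simpa using hp⟩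
        set p := Finset.max' _ hne with hpdef
        have hp : p < i ∧ s p ≠ 0 := (Finset.mem_filter.1 (Finset.max'_mem _ hne)).2
        have hbetw : ∀ l, p < l → l < i → s l = 0 := by
          intro l hpl hli
          by_contra hl0
          exact absurd (Finset.le_max' _ l (by simpa using ⟨hli, hl0⟩)) (not_le.2 hpl)
        have hsp := ih p hp.1 hp.2
        by_cases hiT : s p * s i = -1
        · have hci : c i = c p + 1 := by
            have : T.filter (· ≤ i) = insert i (T.filter (· ≤ p)) := by
              ext q
              simp only [Finset.mem_filter, Finset.mem_insert]
              constructor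
              · rintro ⟨hq, hqi⟩
                rcases hqi.eq_or_lt with rfl | hlt
                · exact Or.inl rfl
                · refine Or.inr ⟨hq, not_lt.1 fun hpq => hTne q hq (hbetw q hpq hlt)⟩
              · rintro (rfl | ⟨hq, hqp⟩)
                · exact ⟨(hTmem q).2 ⟨p, hp.1, hiT, hbetw⟩, le_rfl⟩
                · exact ⟨hq, hqp.trans hp.1.le⟩
            simp only [hc]
            rw [this, Finset.card_insert_of_notMem]
            simp [hp.1]
          rw [hci, pow_succ, ← mul_assoc, ← hsp]
          revert hiT hi
          generalize s p = a
          generalize s i = b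
          revert a b
          decide
        · have hci : c i = c p := by
            have : T.filter (· ≤ i) = T.filter (· ≤ p) := by
              ext q
              simp only [Finset.mem_filter]
              constructor
              · rintro ⟨hq, hqi⟩
                refine ⟨hq, not_lt.1 fun hpq => ?_⟩
                rcases hqi.eq_or_lt with rfl | hlt
                · obtain ⟨p', hp'q, hp', hp'b⟩ := (hTmem q).1 hq
                  rcases lt_trichotomy p p' with h1 | h1 | h1
                  · simp [hbetw p' h1 hp'q] at hp'
                  · exact hiT (h1 ▸ hp')
                  · exact hp.2 (hp'b p h1 hp.1)
                · exact hTne q hq (hbetw q hpq hlt)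
              · rintro ⟨hq, hqp⟩
                exact ⟨hq, hqp.trans hp.1.le⟩
            simp only [hc]
            rw [this]
          rw [hci, ← hsp]
          have hp2 := hp.2
          revert hiT hi hp2
          generalize s p = a
          generalize s i = b
          revert a b
          decide
      · push Not at hex
        have : i = f := by
          rcases lt_trichotomy i f with h1 | h1 | h1
          · exact absurd (hfmin i h1) hi
          · exact h1
          · exact absurd (hex f h1) hf0
        rw [this, hcf, pow_zero, mul_one]
  · intro k
    induction k with
    | zero => exact fun _ => ⟨f, hf0, hcf⟩
    | succ k ih =>
      intro hk
      obtain ⟨i, -, hik⟩ := ih (by omega)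
      have hne : (T.filter (i < ·)).Nonempty := by
        by_contra hemp
        rw [Finset.not_nonempty_iff_eq_empty, Finset.filter_eq_empty_iff] at hemp
        have : T.filter (· ≤ i) = T := Finset.filter_true_of_mem fun q hq => not_lt.1 (hemp hq)
        simp only [hc, this] at hik
        omega
      set q := Finset.min' _ hne
      have hq : q ∈ T ∧ i < q := Finset.mem_filter.1 (Finset.min'_mem _ hne)
      refine ⟨q, hTne q hq.1, ?_⟩
      have : T.filter (· ≤ q) = insert q (T.filter (· ≤ i)) := by
        ext t
        simp only [Finset.mem_filter, Finset.mem_insert]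
        constructor
        · rintro ⟨ht, htq⟩
          by_cases hti : t ≤ i
          · exact Or.inr ⟨ht, hti⟩
          · exact Or.inl (le_antisymm htq
              (Finset.min'_le _ t (by simpa using ⟨ht, not_le.1 hti⟩)))
        · rintro (rfl | ⟨ht, hti⟩)
          · exact ⟨hq.1, le_rfl⟩
          · exact ⟨ht, hti.trans hq.2.le⟩
      simp only [hc] at hik ⊢
      rw [this, Finset.card_insert_of_notMem, hik]
      simp [hq.2]

/-- Along a strictly increasing sequence of alternating nonzero entries, the block numbers
increase at least by one in each step. -/
theorem add_le_block_of_alternating {n r : ℕ} {s : Fin n → SignType} {b : Fin n → ℕ}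
    {σ τ : SignType} (hb : Monotone b) (hs : ∀ i, s i ≠ 0 → s i = σ * (-1) ^ b i)
    (I : Fin (r + 1) ↪o Fin n) (hτ : τ ≠ 0) (hI : ∀ k, s (I k) = τ * (-1) ^ (k : ℕ))
    (k : Fin (r + 1)) : b (I 0) + k ≤ b (I k) := by
  induction k using Fin.induction with
  | zero => simp
  | succ k ih =>
    have h1 : b (I k.castSucc) ≤ b (I k.succ) := hb (I.monotone (Fin.castSucc_lt_succ).le)
    have h2 : b (I k.castSucc) ≠ b (I k.succ) := by
      intro heq
      have hne : ∀ k, s (I k) ≠ 0 := fun k => by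
        rw [hI k]; exact mul_ne_zero hτ (neg_one_pow_signType_ne_zero _)
      have e1 := hs _ (hne k.castSucc)
      have e2 := hs _ (hne k.succ)
      rw [heq, ← e2, hI, hI] at e1
      simp only [Fin.val_castSucc, Fin.val_succ, pow_succ, ← mul_assoc] at e1
      have h3 : τ * (-1) ^ (k : ℕ) ≠ 0 := mul_ne_zero hτ (neg_one_pow_signType_ne_zero _)
      revert e1 h3
      generalize τ * (-1) ^ (k : ℕ) = a
      revert a
      decide
    simp only [Fin.val_castSucc, Fin.val_succ] at ih ⊢
    omega

theorem le_signChanges_of_alternating {n r : ℕ} {s : Fin n → SignType} {τ : SignType}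
    (I : Fin (r + 1) ↪o Fin n) (hτ : τ ≠ 0) (hI : ∀ k, s (I k) = τ * (-1) ^ (k : ℕ)) :
    r ≤ signChanges s := by
  obtain ⟨b, σ, -, hb, hle, hs, -⟩ := exists_blocks s
    ⟨I 0, by rw [hI 0]; exact mul_ne_zero hτ (neg_one_pow_signType_ne_zero _)⟩
  have := add_le_block_of_alternating hb hs I hτ hI (Fin.last r)
  have := hle (I (Fin.last r))
  simp only [Fin.val_last] at *
  omega

/-- Choosing one nonzero entry in each of the first `r + 1` blocks. -/
theorem exists_orderEmb_of_blocks {n r : ℕ} {s : Fin n → SignType} {b : Fin n → ℕ}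
    (hb : Monotone b) (hr : r ≤ signChanges s)
    (hsurj : ∀ k ≤ signChanges s, ∃ i, s i ≠ 0 ∧ b i = k) :
    ∃ I : Fin (r + 1) ↪o Fin n, ∀ k, s (I k) ≠ 0 ∧ b (I k) = k := by
  have : Nonempty (Fin n) := ⟨(hsurj 0 (Nat.zero_le _)).choose⟩
  choose! g hg using hsurj
  have hg' : ∀ k : Fin (r + 1), s (g k) ≠ 0 ∧ b (g k) = k := fun k => hg k (by omega)
  refine ⟨OrderEmbedding.ofStrictMono (fun k => g k) fun k l hkl => ?_, hg'⟩
  by_contra hle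
  have := hb (not_lt.1 hle)
  rw [(hg' k).2, (hg' l).2] at this
  exact absurd hkl (not_lt.2 this)

theorem signChanges_add_one_le_card {n : ℕ} {s : Fin n → SignType} (h : ∃ i, s i ≠ 0)
    (t : Finset (Fin n)) (ht : ∀ i, s i ≠ 0 → i ∈ t) : signChanges s + 1 ≤ t.card := by
  obtain ⟨b, -, -, hb, -, -, hsurj⟩ := exists_blocks s h
  obtain ⟨I, hI⟩ := exists_orderEmb_of_blocks hb le_rfl hsurj
  have := Finset.card_le_card_of_injOn (s := Finset.univ) (t := t) I
    (fun k _ => ht _ (hI k).1) I.injective.injOn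
  simpa using this

theorem isMaxFilling_exists {n : ℕ} {y : Fin n → ℝ} (hy : y ≠ 0) : ∃ s, IsMaxFilling y s := by
  classical
  have hne : (Finset.univ.filter fun s : Fin n → SignType => IsFilling y s).Nonempty := by
    refine ⟨fun i => if y i = 0 then 1 else SignType.sign (y i), ?_⟩
    simp only [Finset.mem_filter, Finset.mem_univ, true_and]
    refine ⟨fun i => ?_, fun i hi => by simp [hi]⟩
    by_cases h : y i = 0 <;> simp [h]
  obtain ⟨s, hs, hmax⟩ := Finset.exists_mem_eq_sup _ hne signChanges
  refine ⟨s, by simpa using hs, ?_⟩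
  rw [sPlus, if_neg hy, ← hmax]

theorem signChanges_le_sPlus {n : ℕ} {y : Fin n → ℝ} (hy : y ≠ 0) {s : Fin n → SignType}
    (hs : IsFilling y s) : signChanges s ≤ sPlus y := by
  classical
  rw [sPlus, if_neg hy]
  exact Finset.le_sup (f := signChanges) (by simpa using hs)

theorem sPlus_zero {n : ℕ} : sPlus (0 : Fin n → ℝ) = n := by simp [sPlus]

theorem sPlus_lt {n : ℕ} {y : Fin n → ℝ} (hy : y ≠ 0) : sPlus y + 1 ≤ n := by
  obtain ⟨s, hs, hmax⟩ := isMaxFilling_exists hy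
  obtain ⟨i, hi⟩ := Function.ne_iff.1 hy
  rw [← hmax]
  simpa using signChanges_add_one_le_card ⟨i, hs.1 i⟩ Finset.univ (by simp)

theorem sPlus_le {n : ℕ} (y : Fin n → ℝ) : sPlus y ≤ n := by
  by_cases hy : y = 0
  · rw [hy, sPlus_zero]
  · have := sPlus_lt hy
    omega

theorem sMinus_add_one_le_card {n : ℕ} {x : Fin n → ℝ} (hx : x ≠ 0)
    (t : Finset (Fin n)) (ht : ∀ i, x i ≠ 0 → i ∈ t) : sMinus x + 1 ≤ t.card := by
  obtain ⟨i, hi⟩ := Function.ne_iff.1 hx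
  exact signChanges_add_one_le_card ⟨i, by simpa using hi⟩ t (by simpa using ht)

theorem sMinus_lt {n : ℕ} (hn : 1 ≤ n) (x : Fin n → ℝ) : sMinus x + 1 ≤ n := by
  by_cases hx : x = 0
  · subst hx
    simpa [sMinus, signChanges] using hn
  · simpa using sMinus_add_one_le_card hx Finset.univ (by simp)

/-- A weakly alternating subsequence of length `r + 1` forces `r ≤ S⁺(y)`. -/
theorem le_sPlus_of_alternating {n r : ℕ} {y : Fin n → ℝ} {τ : SignType}
    (I : Fin (r + 1) ↪o Fin n) (hτ : τ ≠ 0)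
    (hI : ∀ k, y (I k) = 0 ∨ SignType.sign (y (I k)) = τ * (-1) ^ (k : ℕ)) : r ≤ sPlus y := by
  classical
  by_cases hy : y = 0
  · have := Fintype.card_le_of_injective I I.injective
    simp only [Fintype.card_fin] at this
    rw [hy, sPlus_zero]
    omega
  -- Zeros on the range of `I` receive the sign that continues the alternation; the remaining zeros
  -- may receive any sign.
  · set s : Fin n → SignType := fun i =>
      if y i ≠ 0 then SignType.sign (y i)
      else if h : ∃ k, I k = i then τ * (-1) ^ (h.choose : ℕ) else 1 with hs
    have hfill : IsFilling y s := by
      refine ⟨fun i => ?_, fun i hi => by simp [hs, hi]⟩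
      simp only [hs]
      split_ifs with h1 h2
      · simpa using h1
      · exact mul_ne_zero hτ (neg_one_pow_signType_ne_zero _)
      · decide
    refine le_trans (le_signChanges_of_alternating I hτ fun k => ?_)
      (signChanges_le_sPlus hy hfill)
    by_cases h0 : y (I k) = 0
    · have hex : ∃ l, I l = I k := ⟨k, rfl⟩
      have : hex.choose = k := I.injective hex.choose_spec
      simp only [hs, h0, ne_eq, not_true_eq_false, if_false, dif_pos hex, this]
    · simp only [hs, ne_eq, h0, not_false_eq_true, if_true]
      exact (hI k).resolve_left h0

/-! ### Determinants and adjugates whose expansions do not cancel. -/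

open Matrix

theorem sign_sum_of_forall {ι : Type*} (s : Finset ι) (f : ι → ℝ) (τ : SignType)
    (hf : ∀ i ∈ s, f i = 0 ∨ SignType.sign (f i) = τ) (h : ∃ i ∈ s, f i ≠ 0) :
    SignType.sign (∑ i ∈ s, f i) = τ := by
  obtain ⟨j, hj, hj0⟩ := h
  have hjτ := (hf j hj).resolve_left hj0
  rcases lt_or_gt_of_ne hj0 with hneg | hpos
  · have hτ : τ = -1 := by rw [← hjτ, sign_neg hneg]
    subst hτ
    refine sign_neg (Finset.sum_neg' (fun i hi => ?_) ⟨j, hj, hneg⟩)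
    rcases hf i hi with h0 | h0
    · exact h0.le
    · exact (sign_eq_neg_one_iff.1 h0).le
  · have hτ : τ = 1 := by rw [← hjτ, sign_pos hpos]
    subst hτ
    refine sign_pos (Finset.sum_pos' (fun i hi => ?_) ⟨j, hj, hpos⟩)
    rcases hf i hi with h0 | h0
    · exact h0.ge
    · exact (sign_eq_one_iff.1 h0).le

theorem sign_neg_one_pow (k : ℕ) : SignType.sign ((-1 : ℝ) ^ k) = (-1) ^ k := by
  rw [sign_pow, Left.sign_neg, sign_one]

theorem neg_one_pow_mul_self (k : ℕ) : (-1 : SignType) ^ k * (-1) ^ k = 1 :=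
  sign_mul_self_of_ne_zero (neg_one_pow_signType_ne_zero k)

/-- The cofactor signs `(-1) ^ j` in row `0` of the adjugate meet the alternation of `w`, so every
nonzero term of the sum has sign `η * σ`. -/
theorem sign_adjugate_mulVec_zero {k : ℕ} (B : Matrix (Fin (k + 1)) (Fin (k + 1)) ℝ)
    {w : Fin (k + 1) → ℝ} {η σ : SignType} (hη0 : η ≠ 0)
    (hη : ∀ j : Fin (k + 1), SignType.sign (B.submatrix j.succAbove Fin.succ).det = η)
    (hw : ∀ j, w j = 0 ∨ SignType.sign (w j) = σ * (-1) ^ (j : ℕ)) (hw0 : w ≠ 0) :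
    SignType.sign ((B.adjugate *ᵥ w) 0) = η * σ := by
  have hterm : ∀ j, SignType.sign (B.adjugate 0 j) = (-1) ^ (j : ℕ) * η := by
    intro j
    rw [adjugate_fin_succ_eq_det_submatrix, sign_mul, sign_neg_one_pow, Fin.succAbove_zero, hη]
    simp
  rw [Matrix.mulVec, dotProduct]
  refine sign_sum_of_forall _ _ _ (fun j _ => ?_) ?_
  · rcases hw j with h | h
    · exact Or.inl (by rw [h, mul_zero])
    · right
      rw [sign_mul, hterm, h]
      calc (-1) ^ (j : ℕ) * η * (σ * (-1) ^ (j : ℕ))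
          = η * σ * ((-1) ^ (j : ℕ) * (-1) ^ (j : ℕ)) := by ac_rfl
        _ = η * σ := by rw [neg_one_pow_mul_self, mul_one]
  · obtain ⟨j, hj⟩ := Function.ne_iff.1 hw0
    refine ⟨j, Finset.mem_univ _, mul_ne_zero ?_ hj⟩
    rw [← sign_ne_zero, hterm]
    exact mul_ne_zero (neg_one_pow_signType_ne_zero _) hη0

/-- Minors of a matrix whose columns are nonnegative combinations of successive blocks of
columns of `A`. -/
theorem sign_det_mul_of_blocks {n s : ℕ} (A : Matrix (Fin s) (Fin n) ℝ)
    (X : Matrix (Fin n) (Fin s) ℝ) {η : SignType}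
    (hA : ∀ J : Fin s ↪o Fin n, SignType.sign (A.submatrix id J).det = η) (hη : η ≠ 0)
    (hX : ∀ i j, 0 ≤ X i j) (hne : ∀ j, ∃ i, X i j ≠ 0)
    (hord : ∀ i i' j j', X i j ≠ 0 → X i' j' ≠ 0 → j < j' → i < i') :
    SignType.sign (A * X).det = η := by
  -- Multilinearity in the columns: `f` selects one column of `A` for each column of the product.
  have hexp : (A * X).det = ∑ f : Fin s → Fin n, (∏ j, X (f j) j) * (A.submatrix id f).det := by
    have h1 : (A * X)ᵀ = fun j => ∑ i, X i j • (fun a => A a i) := by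
      ext j a
      simp [Matrix.mul_apply, Finset.sum_apply, mul_comm]
    rw [← det_transpose, h1]
    change detRowAlternating.toMultilinearMap _ = _
    rw [MultilinearMap.map_sum]
    refine Finset.sum_congr rfl fun f _ => ?_
    rw [MultilinearMap.map_smul_univ, smul_eq_mul, ← det_transpose (A.submatrix id f)]
    rfl
  have hterm : ∀ f : Fin s → Fin n, (∀ j, X (f j) j ≠ 0) →
      SignType.sign ((∏ j, X (f j) j) * (A.submatrix id f).det) = η := by
    intro f hf
    -- Successive supports make every selection of nonzero weight increasing, so only genuine minors
    -- of `A` occur, with positive weights.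
    have hmono : StrictMono f := fun j j' hjj => hord _ _ _ _ (hf j) (hf j') hjj
    have hpos : 0 < ∏ j, X (f j) j :=
      Finset.prod_pos fun j _ => lt_of_le_of_ne (hX _ _) (hf j).symm
    rw [sign_mul, sign_pos hpos, one_mul]
    exact hA (OrderEmbedding.ofStrictMono f hmono)
  rw [hexp]
  refine sign_sum_of_forall _ _ _ (fun f _ => ?_) ?_
  · by_cases hf : ∀ j, X (f j) j ≠ 0
    · exact Or.inr (hterm f hf)
    · push Not at hf
      obtain ⟨j, hj⟩ := hf
      exact Or.inl (by
        rw [Finset.prod_eq_zero (f := fun j => X (f j) j) (Finset.mem_univ j) hj, zero_mul])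
  · choose f hf using hne
    exact ⟨f, Finset.mem_univ _, by rw [← sign_ne_zero, hterm f hf]; exact hη⟩

/-! ### From contiguous minors to all minors. -/

/-- A three-term identity between the maximal minors of a matrix with one row more
than columns and those of the matrix without its last column. -/
theorem three_term_identity {q : ℕ} (C : Matrix (Fin (q + 3)) (Fin (q + 2)) ℝ)
    (p : Fin (q + 1)) :
    (C.submatrix p.succ.castSucc.succAbove id).det *
        (C.submatrix (fun i : Fin (q + 1) => i.succ.castSucc) Fin.castSucc).det =
      (C.submatrix Fin.succ id).det *
          (C.submatrix (Fin.cons 0 fun i => (p.succAbove i).succ.castSucc) Fin.castSucc).det +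
        (C.submatrix Fin.castSucc id).det *
          (C.submatrix (Fin.snoc (fun i => (p.succAbove i).succ.castSucc) (Fin.last _))
            Fin.castSucc).det := by
  set R' : Fin q → Fin (q + 3) := fun i => (p.succAbove i).succ.castSucc with hR'
  -- `f i` is the determinant, without the last column, of row `i` placed on top of the rows `R'`.
  -- It is a linear combination of the columns of `C` and vanishes on `R'`.
  set f : Fin (q + 3) → ℝ := fun i => ∑ j : Fin (q + 1), C i j.castSucc *
    ((-1) ^ (j : ℕ) * (C.submatrix R' fun l => (j.succAbove l).castSucc).det) with hf
  have hdet : ∀ (R : Fin (q + 1) → Fin (q + 3)) (t : Fin (q + 1)),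
      (∀ i, R (t.succAbove i) = R' i) →
      (C.submatrix R Fin.castSucc).det = (-1) ^ (t : ℕ) * f (R t) := by
    intro R t hR
    rw [det_succ_row _ t, hf, Finset.mul_sum]
    refine Finset.sum_congr rfl fun j _ => ?_
    have : (C.submatrix R Fin.castSucc).submatrix t.succAbove j.succAbove =
        C.submatrix R' fun l => (j.succAbove l).castSucc := by
      ext a b
      simp [hR]
    rw [this, submatrix_apply]
    ring
  have hzero : ∀ i, f (R' i) = 0 := by
    intro i
    have h1 := hdet (Fin.cons (R' i) R') 0 (fun i => by simp)
    rw [det_zero_of_row_eq (i := 0) (j := i.succ) (Fin.succ_ne_zero i).symm] at h1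
    · simpa using h1.symm
    · ext l
      simp
  -- The signed maximal minors are orthogonal to each column of `C`: prepending a copy of column `j`
  -- makes the determinant zero.
  have hrel : ∀ j, ∑ i : Fin (q + 3),
      (-1) ^ (i : ℕ) * (C.submatrix i.succAbove id).det * C i j = 0 := by
    intro j
    set M : Matrix (Fin (q + 3)) (Fin (q + 3)) ℝ :=
      Matrix.of fun i => Fin.cons (C i j) (C i) with hM
    have h0 : M.det = 0 := det_zero_of_column_eq (i := 0) (j := j.succ)
      (Fin.succ_ne_zero j).symm fun i => by simp [hM]
    rw [det_succ_column_zero] at h0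
    rw [← h0]
    refine Finset.sum_congr rfl fun i _ => ?_
    have : M.submatrix i.succAbove Fin.succ = C.submatrix i.succAbove id := by
      ext a b
      simp [hM]
    rw [this]
    simp only [hM, of_apply, Fin.cons_zero]
    ring
  have hsum : ∑ i : Fin (q + 3), (-1) ^ (i : ℕ) * (C.submatrix i.succAbove id).det * f i = 0 := by
    simp only [hf, Finset.mul_sum]
    rw [Finset.sum_comm]
    refine Finset.sum_eq_zero fun j _ => ?_
    rw [← mul_zero ((-1) ^ (j : ℕ) * (C.submatrix R' fun l => (j.succAbove l).castSucc).det),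
      ← hrel j.castSucc, Finset.mul_sum]
    exact Finset.sum_congr rfl fun i _ => by ring
  have hp := hdet (fun i => i.succ.castSucc) p fun i => rfl
  have h0 := hdet (Fin.cons 0 R') 0 fun i => by simp
  have hl := hdet (Fin.snoc R' (Fin.last _)) (Fin.last _) fun i => by simp
  -- Only the first row, the last row and the row indexed by `p` lie outside `R'`; they give the
  -- three terms.
  rw [Fin.sum_univ_castSucc, Fin.sum_univ_succ, Fin.sum_univ_succAbove _ p,
    Finset.sum_eq_zero (s := Finset.univ) fun i _ => by
      rw [show f ((p.succAbove i).succ.castSucc) = 0 from hzero i, mul_zero]] at hsum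
  simp only [Fin.cons_zero, Fin.snoc_last, Fin.val_last, Fin.val_zero, pow_zero, one_mul] at h0 hl
  simp only [Fin.castSucc_zero, Fin.succAbove_zero, Fin.succAbove_last, Fin.val_last,
    Fin.val_castSucc, Fin.val_succ, Fin.val_zero, pow_zero, one_mul, add_zero] at hsum
  rw [hp, h0, hl]
  have hpow : (-1 : ℝ) ^ (q + 2) = (-1) ^ q := by rw [pow_add]; simp
  rw [hpow, pow_succ] at hsum
  linear_combination -hsum

theorem sign_add_of_eq {a b : ℝ} {τ : SignType} (ha : SignType.sign a = τ)
    (hb : SignType.sign b = τ) : SignType.sign (a + b) = τ := by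
  rcases lt_trichotomy a 0 with h | h | h
  · rw [sign_neg h] at ha
    subst ha
    exact sign_neg (add_neg h (sign_eq_neg_one_iff.1 hb))
  · rw [h, zero_add, hb]
  · rw [sign_pos h] at ha
    subst ha
    exact sign_pos (add_pos h (sign_eq_one_iff.1 hb))

theorem strictMono_insertNth {m r : ℕ} {I : Fin (r + 1) → Fin m} (hI : StrictMono I)
    {j : Fin r} {l : Fin m} (h1 : I j.castSucc < l) (h2 : l < I j.succ) :
    StrictMono (j.succ.castSucc.insertNth l I : Fin (r + 2) → Fin m) := by
  intro a b hab
  rcases Fin.eq_self_or_eq_succAbove j.succ.castSucc a with rfl | ⟨a, rfl⟩ <;>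
    rcases Fin.eq_self_or_eq_succAbove j.succ.castSucc b with rfl | ⟨b, rfl⟩
  · exact absurd hab (lt_irrefl _)
  · rw [Fin.insertNth_apply_same, Fin.insertNth_apply_succAbove]
    refine h2.trans_le (hI.monotone ?_)
    rw [Fin.lt_succAbove_iff_le_castSucc] at hab
    exact hab
  · rw [Fin.insertNth_apply_same, Fin.insertNth_apply_succAbove]
    refine (hI.monotone ?_).trans_lt h1
    rw [Fin.succAbove_lt_iff_castSucc_lt] at hab
    simp only [Fin.lt_def, Fin.le_def, Fin.val_castSucc, Fin.val_succ] at hab ⊢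
    omega
  · rw [Fin.insertNth_apply_succAbove, Fin.insertNth_apply_succAbove]
    exact hI ((Fin.strictMono_succAbove _).lt_iff_lt.1 hab)

/-- If all minors of order `r` without the last column have the same nonzero sign, then a common
sign of the maximal minors in consecutive rows is the sign of all maximal minors. -/
theorem sign_det_of_contiguous_rows {m r : ℕ} (C : Matrix (Fin m) (Fin (r + 1)) ℝ)
    {η η' : SignType} (hη' : η' ≠ 0)
    (hC' : ∀ I : Fin r ↪o Fin m, SignType.sign (C.submatrix I Fin.castSucc).det = η')
    (hC : ∀ I : Fin (r + 1) ↪o Fin m, (∀ j, (I j : ℕ) = I 0 + j) →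
      SignType.sign (C.submatrix I id).det = η)
    (I : Fin (r + 1) ↪o Fin m) : SignType.sign (C.submatrix I id).det = η := by
  -- Induction on the spread of the rows. A row `l` inserted in a gap of `I` gives `K`; dropping the
  -- first or the last row of `K` gives two selections of smaller spread.
  induction hd : (I (Fin.last r) : ℕ) - I 0 using Nat.strong_induction_on generalizing I with
  | _ d ih =>
    by_cases hI : ∀ j, (I j : ℕ) = I 0 + j
    · exact hC I hI
    obtain ⟨j, hj⟩ : ∃ j : Fin r, (I j.castSucc : ℕ) + 1 < I j.succ := by
      by_contra hcon
      push Not at hcon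
      refine hI fun j => ?_
      induction j using Fin.induction with
      | zero => simp
      | succ j hj =>
        have h1 := hcon j
        have h2 : (I j.castSucc : ℕ) < I j.succ := I.strictMono Fin.castSucc_lt_succ
        simp only [Fin.val_castSucc, Fin.val_succ] at hj ⊢
        omega
    obtain ⟨q, rfl⟩ : ∃ q, r = q + 1 := ⟨r - 1, by have := j.isLt; omega⟩
    set l : Fin m := ⟨I j.castSucc + 1, by have := (I j.succ).isLt; omega⟩ with hl
    have hKmono := strictMono_insertNth (j := j) (l := l) I.strictMono
      (Fin.lt_def.2 (Nat.lt_succ_self _)) (Fin.lt_def.2 hj)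
    set K : Fin (q + 3) → Fin m := j.succ.castSucc.insertNth l I with hK
    have hKI : ∀ i, K (j.succ.castSucc.succAbove i) = I i := fun i => by
      rw [hK, Fin.insertNth_apply_succAbove]
    have hK0 : K 0 = I 0 := by
      rw [← hKI 0, Fin.succAbove_ne_zero_zero]
      simp only [ne_eq, Fin.ext_iff, Fin.val_castSucc, Fin.val_succ, Fin.val_zero]
      omega
    have hKl : K (Fin.last _) = I (Fin.last _) := by
      rw [← hKI (Fin.last _), Fin.succAbove_ne_last_last]
      simp only [ne_eq, Fin.ext_iff, Fin.val_castSucc, Fin.val_succ, Fin.val_last]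
      have := j.isLt
      omega
    have hid := three_term_identity (C.submatrix K id) j
    simp only [submatrix_submatrix, Function.id_comp, Function.comp_id] at hid
    have hKI' : K ∘ j.succ.castSucc.succAbove = I := funext hKI
    have hlt : ∀ a b, a < b → (K a : ℕ) < K b := fun a b hab => hKmono hab
    have hA0 := ih _ (by
        have h1 := hlt 0 1 (by simp)
        have h2 := hlt 1 (Fin.last _) (by simp [Fin.lt_def])
        rw [hK0] at h1
        rw [hKl] at h2
        simp only [OrderEmbedding.coe_ofStrictMono, Function.comp_apply, Fin.succ_last,
          Fin.succ_zero_eq_one, hKl]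
        omega)
      (OrderEmbedding.ofStrictMono (K ∘ Fin.succ) (hKmono.comp (Fin.strictMono_succ))) rfl
    have hAl := ih _ (by
        have h1 := hlt 0 (Fin.last _).castSucc (by simp [Fin.lt_def])
        have h2 := hlt (Fin.last _).castSucc (Fin.last _) (by simp [Fin.lt_def])
        rw [hK0] at h1
        rw [hKl] at h2
        simp only [OrderEmbedding.coe_ofStrictMono, Function.comp_apply, Fin.castSucc_zero, hK0]
        omega)
      (OrderEmbedding.ofStrictMono (K ∘ Fin.castSucc) (hKmono.comp (Fin.strictMono_castSucc))) rfl
    have hB : ∀ R : Fin (q + 1) → Fin (q + 3), StrictMono R →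
        SignType.sign (C.submatrix (K ∘ R) Fin.castSucc).det = η' := fun R hR =>
      hC' (OrderEmbedding.ofStrictMono (K ∘ R) (hKmono.comp hR))
    have hmid : StrictMono fun i : Fin q => (j.succAbove i).succ.castSucc := fun a b hab =>
      Fin.strictMono_castSucc (Fin.strictMono_succ (Fin.strictMono_succAbove j hab))
    have hBp := hB (fun i => i.succ.castSucc) fun a b hab =>
      Fin.strictMono_castSucc (Fin.strictMono_succ hab)
    have hB0 := hB (Fin.cons 0 fun i => (j.succAbove i).succ.castSucc) (by
      intro a b hab
      induction a using Fin.cases with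
      | zero =>
        induction b using Fin.cases with
        | zero => exact absurd hab (lt_irrefl _)
        | succ b => simp [Fin.lt_def]
      | succ a =>
        induction b using Fin.cases with
        | zero => exact absurd hab (Fin.not_lt_zero _)
        | succ b =>
          rw [Fin.cons_succ, Fin.cons_succ]
          exact hmid (Fin.succ_lt_succ_iff.1 hab))
    have hBl := hB (Fin.snoc (fun i => (j.succAbove i).succ.castSucc) (Fin.last _)) (by
      intro a b hab
      induction b using Fin.lastCases with
      | last =>
        induction a using Fin.lastCases with
        | last => exact absurd hab (lt_irrefl _)
        | cast a =>
          rw [Fin.snoc_castSucc, Fin.snoc_last]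
          exact Fin.castSucc_lt_last _
      | cast b =>
        induction a using Fin.lastCases with
        | last => exact absurd hab (not_lt.2 (Fin.le_last _))
        | cast a =>
          rw [Fin.snoc_castSucc, Fin.snoc_castSucc]
          exact hmid hab)
    simp only [OrderEmbedding.coe_ofStrictMono] at hA0 hAl
    rw [hKI'] at hid
    -- Both products on the right have sign `η * η'`, so they cannot cancel, and `η'` divides out on
    -- the left.
    have hfin := congrArg SignType.sign hid
    rw [sign_mul, hBp, sign_add_of_eq (τ := η * η') (by rw [sign_mul, hA0, hB0])
      (by rw [sign_mul, hAl, hBl])] at hfin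
    exact mul_right_cancel₀ hη' hfin

/-- If all minors of order `r` have the same nonzero sign, then a common sign of the contiguous
minors of order `r + 1` is the sign of all minors of order `r + 1`. -/
theorem sign_det_of_contiguous {m n r : ℕ} (A : Matrix (Fin m) (Fin n) ℝ)
    {η η' : SignType} (hη' : η' ≠ 0)
    (hA' : ∀ (I : Fin r ↪o Fin m) (J : Fin r ↪o Fin n),
      SignType.sign (A.submatrix I J).det = η')
    (hA : ∀ a b ha hb, SignType.sign (contiguous A (r + 1) a b ha hb).det = η)
    (I : Fin (r + 1) ↪o Fin m) (J : Fin (r + 1) ↪o Fin n) :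
    SignType.sign (A.submatrix I J).det = η := by
  have hrows : ∀ (I : Fin (r + 1) ↪o Fin m) (J : Fin (r + 1) ↪o Fin n),
      (∀ j, (J j : ℕ) = J 0 + j) → SignType.sign (A.submatrix I J).det = η := by
    intro I J hJ
    refine sign_det_of_contiguous_rows (A.submatrix id J) hη'
      (fun I' => hA' I' (Fin.castSuccOrderEmb.trans J)) (fun I' hI' => ?_) I
    have h1 := (I' (Fin.last r)).isLt
    have h2 := (J (Fin.last r)).isLt
    rw [hI', Fin.val_last] at h1
    rw [hJ, Fin.val_last] at h2
    rw [← hA (I' 0) (J 0) (by omega) (by omega)]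
    congr 2
    ext i j
    simp only [submatrix_apply, contiguous, id]
    congr 1
    · exact Fin.ext (hI' i)
    · exact Fin.ext (hJ j)
  -- The same argument on the transpose frees the columns, now that arbitrary rows are allowed.
  have := sign_det_of_contiguous_rows (A.submatrix I id)ᵀ (η := η) hη'
    (fun J' => by
      rw [← hA' (Fin.castSuccOrderEmb.trans I) J', ← det_transpose]
      rfl)
    (fun J' hJ' => by
      rw [← hrows I J' hJ', ← det_transpose]
      rfl) J
  rw [← this, ← det_transpose]
  rfl

/-! ### From the signs of minors to variation diminution. -/

theorem sign_signType_cast (τ : SignType) : SignType.sign (τ : ℝ) = τ := by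
  cases τ <;> simp

/-- A nonzero vector `x` is the image of an alternating vector of signs, of length `S⁻(x) + 1`,
under a nonnegative matrix with successive column supports. -/
theorem exists_blockMatrix {n : ℕ} {x : Fin n → ℝ} (hx : x ≠ 0) :
    ∃ (X : Matrix (Fin n) (Fin (sMinus x + 1)) ℝ) (σ : SignType), σ ≠ 0 ∧
      (∀ i j, 0 ≤ X i j) ∧ (∀ j, ∃ i, X i j ≠ 0) ∧
      (∀ i i' j j', X i j ≠ 0 → X i' j' ≠ 0 → j < j' → i < i') ∧
      (X *ᵥ fun j => ((σ * (-1) ^ (j : ℕ) : SignType) : ℝ)) = x ∧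
      (∀ p, IsFirstNonzero x p → SignType.sign (x p) = σ) ∧
      ∀ p, IsLastNonzero x p → SignType.sign (x p) = σ * (-1) ^ sMinus x := by
  obtain ⟨i₀, hi₀⟩ := Function.ne_iff.1 hx
  obtain ⟨b, σ, hσ, hb, hle, hs, hsurj⟩ :=
    exists_blocks (fun i => SignType.sign (x i)) ⟨i₀, by simpa using hi₀⟩
  change ∀ i, b i ≤ sMinus x at hle
  change ∀ k ≤ sMinus x, _ at hsurj
  simp only [sign_ne_zero] at hs hsurj
  -- Column `j` carries the absolute values of the entries in block `j`; the alternating vector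
  -- restores their signs.
  refine ⟨Matrix.of fun i j => if b i = j then |x i| else 0, σ, hσ, fun i j => ?_, fun j => ?_,
    fun i i' j j' hi hi' hjj => ?_, ?_, fun p hp => ?_, fun p hp => ?_⟩
  · rw [of_apply]
    split_ifs
    exacts [abs_nonneg _, le_rfl]
  · obtain ⟨i, hi, hij⟩ := hsurj j (by omega)
    exact ⟨i, by simpa [hij] using hi⟩
  · simp only [of_apply, ne_eq, ite_eq_right_iff, Classical.not_imp] at hi hi'
    by_contra hle'
    have := hb (not_lt.1 hle')
    rw [hi.1, hi'.1] at this
    exact absurd hjj (not_lt.2 this)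
  · ext i
    rw [mulVec, dotProduct, Finset.sum_eq_single ⟨b i, Nat.lt_succ_of_le (hle i)⟩]
    · by_cases hi : x i = 0
      · simp [hi]
      · simp only [of_apply, if_true]
        rw [← hs i hi, mul_comm, sign_mul_abs]
    · intro j _ hj
      rw [of_apply, if_neg fun h => hj (Fin.ext h.symm), zero_mul]
    · simp
  · obtain ⟨i, hi, hi0⟩ := hsurj 0 (Nat.zero_le _)
    have : b p ≤ b i := hb (not_lt.1 fun h => hi (hp.2 i h))
    rw [hs p hp.1, show b p = 0 by omega, pow_zero, mul_one]
  · obtain ⟨i, hi, hil⟩ := hsurj (sMinus x) le_rfl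
    have h1 : b i ≤ b p := hb (not_lt.1 fun h => hi (hp.2 i h))
    have h2 := hle p
    rw [hs p hp.1, show b p = sMinus x by omega]

/-- A sequence of nonzero signs with at least `r` changes has an alternating subsequence of
length `r + 1` that starts with the sign of its first entry. -/
theorem exists_alternating {n r : ℕ} {s : Fin n → SignType} (hs : ∀ i, s i ≠ 0) (hn : 1 ≤ n)
    (hr : r ≤ signChanges s) :
    ∃ (I : Fin (r + 1) ↪o Fin n) (τ : SignType), τ ≠ 0 ∧ (∀ k, s (I k) = τ * (-1) ^ (k : ℕ)) ∧
      (∀ i : Fin n, (i : ℕ) = 0 → s i = τ) ∧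
      ∀ i : Fin n, (i : ℕ) + 1 = n → s i = τ * (-1) ^ signChanges s := by
  obtain ⟨b, τ, hτ, hb, hle, hsb, hsurj⟩ := exists_blocks s ⟨⟨0, hn⟩, hs _⟩
  obtain ⟨I, hI⟩ := exists_orderEmb_of_blocks hb hr hsurj
  refine ⟨I, τ, hτ, fun k => by rw [hsb _ (hI k).1, (hI k).2], fun i hi => ?_, fun i hi => ?_⟩
  · obtain ⟨j, -, hj⟩ := hsurj 0 (Nat.zero_le _)
    have : b i ≤ b j := hb (by rw [Fin.le_def]; omega)
    rw [hsb i (hs i), show b i = 0 by omega, pow_zero, mul_one]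
  · obtain ⟨j, -, hj⟩ := hsurj _ le_rfl
    have h1 : b j ≤ b i := hb (by rw [Fin.le_def]; omega)
    have h2 := hle i
    rw [hsb i (hs i), show b i = signChanges s by omega]

theorem IsFilling.eq_zero_or_sign_eq {n : ℕ} {y : Fin n → ℝ} {s : Fin n → SignType}
    (h : IsFilling y s) (i : Fin n) : y i = 0 ∨ SignType.sign (y i) = s i := by
  by_cases hi : y i = 0
  · exact Or.inl hi
  · exact Or.inr (h.2 i hi).symm

/-- Strict sign regularity implies the variation diminishing property. -/
theorem variationDiminishing_of_minors {m n : ℕ} (A : Matrix (Fin m) (Fin n) ℝ)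
    (e : ℕ → SignType) (he : ∀ r ≤ min m n, e r ≠ 0)
    (hA : ∀ r ≤ min m n, ∀ (I : Fin r ↪o Fin m) (J : Fin r ↪o Fin n),
      SignType.sign (A.submatrix I J).det = e r) {x : Fin n → ℝ} (hx : x ≠ 0) :
    sPlus (A *ᵥ x) ≤ sMinus x ∧
      ∀ r, sPlus (A *ᵥ x) = r → sMinus x = r → r < min m n →
        EndSignsAgree (e r * e (r + 1)) (A *ᵥ x) x := by
  obtain ⟨X, σ, hσ, hX, hne, hord, hXd, hfirst, hlast⟩ := exists_blockMatrix hx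
  have hn : sMinus x + 1 ≤ n := by simpa using sMinus_add_one_le_card hx Finset.univ (by simp)
  revert X hfirst hlast
  generalize hr : sMinus x = r at hn ⊢
  intro X hX hne hord hXd hfirst hlast
  set d : Fin (r + 1) → ℝ := fun j => ((σ * (-1) ^ (j : ℕ) : SignType) : ℝ) with hd
  have hd0 : SignType.sign (d 0) = σ := by simp [hd, sign_signType_cast]
  have hdne : d ≠ 0 := fun h => hσ (by rw [← hd0, h]; simp)
  set y := A *ᵥ x with hy
  have hyd : y = (A * X) *ᵥ d := by rw [hy, ← hXd, mulVec_mulVec]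
  -- Here `S⁺ ≤ m` suffices, and the end condition is vacuous since it requires `r < m`.
  by_cases hm : m ≤ r
  · refine ⟨(sPlus_le y).trans hm, fun r' _ h2 h3 => ?_⟩
    omega
  have hmin : r + 1 ≤ min m n := by omega
  have hminor : ∀ I : Fin (r + 1) ↪o Fin m,
      SignType.sign ((A * X).submatrix I id).det = e (r + 1) := fun I => by
    rw [← submatrix_mul_equiv A X I (Equiv.refl _) id]
    exact sign_det_mul_of_blocks _ _ (fun J => hA _ hmin I J) (he _ hmin) hX hne hord
  have hminor' : ∀ I : Fin r ↪o Fin m,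
      SignType.sign ((A * X).submatrix I Fin.succ).det = e r := fun I => by
    rw [← submatrix_mul_equiv A X I (Equiv.refl _) Fin.succ]
    exact sign_det_mul_of_blocks _ _ (fun J => hA _ (by omega) I J) (he _ (by omega))
      (fun i j => hX _ _) (fun j => hne _)
      fun i i' j j' h1 h2 h3 => hord i i' j.succ j'.succ h1 h2 (Fin.succ_lt_succ_iff.2 h3)
  have hwne : ∀ I : Fin (r + 1) ↪o Fin m, (fun k => y (I k)) ≠ 0 := fun I h0 => by
    have hdet : ((A * X).submatrix I id).det ≠ 0 := by
      rw [← sign_ne_zero, hminor I]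
      exact he _ hmin
    refine hdet (exists_mulVec_eq_zero_iff.1 ⟨d, hdne, ?_⟩)
    rw [← h0, hyd]
    rfl
  have hyne : y ≠ 0 := fun h0 =>
    hwne (Fin.castLEOrderEmb (by omega)) (by rw [h0]; rfl)
  have hm1 : 1 ≤ m := by omega
  refine ⟨?_, ?_⟩
  · by_contra hlt
    obtain ⟨s, hs, hsmax⟩ := isMaxFilling_exists hyne
    obtain ⟨K, τ, hτ, hK, -, -⟩ := exists_alternating (r := r + 1) hs.1 hm1 (by omega)
    -- Bordering `A * X` by `y`, a combination of its columns, gives a singular matrix. As `y` is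
    -- column `0` of `C` on the rows `K`, `adj(C) y` has first component `det C = 0`, although the
    -- terms of that component do not cancel.
    set C : Matrix (Fin (r + 2)) (Fin (r + 2)) ℝ :=
      Matrix.of fun k => Fin.cons (y (K k)) fun j => (A * X) (K k) j with hC
    have hCdet : C.det = 0 := by
      refine exists_mulVec_eq_zero_iff.1 ⟨Fin.cons 1 (-d), fun h => ?_, ?_⟩
      · simpa using congrFun h 0
      · ext k
        simp only [mulVec, dotProduct, hC, of_apply, Fin.sum_univ_succ (n := r + 1),
          Fin.cons_zero, Fin.cons_succ, hyd, Pi.neg_apply, mul_neg, Finset.sum_neg_distrib,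
          mul_one, Pi.zero_apply, add_neg_cancel]
    have hsign := sign_adjugate_mulVec_zero C (w := fun k => y (K k)) (η := e (r + 1)) (σ := τ)
      (he _ hmin)
      (fun k => hminor ((Fin.succAboveOrderEmb k).trans K))
      (fun k => by rw [← hK]; exact hs.eq_zero_or_sign_eq _)
      (fun h => hwne (Fin.castSuccOrderEmb.trans K)
        (funext fun k => congrFun h k.castSucc))
    have hw : (fun k => y (K k)) = C *ᵥ Pi.single 0 1 := by
      rw [mulVec_single_one]
      rfl
    rw [hw, mulVec_mulVec, adjugate_mul, hCdet, zero_smul, zero_mulVec, Pi.zero_apply,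
      sign_zero] at hsign
    exact mul_ne_zero (he _ hmin) hτ hsign.symm
  · rintro r' hp rfl hlt s ⟨hs, hsmax⟩
    obtain ⟨K, τ, hτ, hK, h0, hl⟩ := exists_alternating (r := r) hs.1 hm1 (by omega)
    rw [hsmax, hp] at hl
    -- Cramer's rule `adj(B) (B d) = det(B) d`, compared in component `0`, relates `τ` to `σ`.
    set B := (A * X).submatrix K id with hB
    have hsign := sign_adjugate_mulVec_zero B (w := fun k => y (K k)) (η := e r) (σ := τ)
      (he _ (by omega))
      (fun k => hminor' ((Fin.succAboveOrderEmb k).trans K))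
      (fun k => by rw [← hK]; exact hs.eq_zero_or_sign_eq _) (hwne K)
    have hw : (fun k => y (K k)) = B *ᵥ d := by rw [hyd]; rfl
    rw [hw, mulVec_mulVec, adjugate_mul, smul_mulVec, one_mulVec, Pi.smul_apply, smul_eq_mul,
      sign_mul, hminor K, hd0] at hsign
    have hτσ : τ = e r * e (r + 1) * σ := by
      rw [mul_assoc, hsign, ← mul_assoc, sign_mul_self_of_ne_zero (he _ (by omega)), one_mul]
    refine ⟨fun i p hi hp => ?_, fun i p hi hp => ?_⟩
    · rw [h0 i hi, hfirst p hp, hτσ]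
    · rw [hl i hi, hlast p hp, hτσ, mul_assoc]

/-! ### From variation diminution to the signs of minors. -/

theorem signAt_zero {k : ℕ} (ε : Fin k → SignType) : signAt ε 0 = 1 := by simp [signAt]

theorem signAt_ne_zero {k : ℕ} {ε : Fin k → SignType} (hε : ∀ i, ε i = 1 ∨ ε i = -1) (r : ℕ) :
    signAt ε r ≠ 0 := by
  unfold signAt
  split_ifs with h
  · rcases hε ⟨r - 1, by omega⟩ with h1 | h1 <;> rw [h1] <;> decide
  · decide

/-- Extension of a vector by zero along an order embedding of the index sets. -/
noncomputable def extendZero {k n : ℕ} (J : Fin k ↪o Fin n) (x : Fin k → ℝ) : Fin n → ℝ :=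
  Function.extend J x 0

theorem extendZero_apply {k n : ℕ} (J : Fin k ↪o Fin n) (x : Fin k → ℝ) (j : Fin k) :
    extendZero J x (J j) = x j :=
  J.injective.extend_apply x 0 j

theorem extendZero_of_notMem {k n : ℕ} (J : Fin k ↪o Fin n) (x : Fin k → ℝ) {l : Fin n}
    (hl : l ∉ Set.range J) : extendZero J x l = 0 :=
  Function.extend_apply' x (0 : Fin n → ℝ) l hl

theorem extendZero_ne_zero {k n : ℕ} (J : Fin k ↪o Fin n) {x : Fin k → ℝ} (hx : x ≠ 0) :
    extendZero J x ≠ 0 := fun h =>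
  hx (funext fun j => by rw [← extendZero_apply J x j, h]; rfl)

theorem mulVec_extendZero {m n k : ℕ} (A : Matrix (Fin m) (Fin n) ℝ) (J : Fin k ↪o Fin n)
    (x : Fin k → ℝ) (i : Fin m) :
    (A *ᵥ extendZero J x) i = (A.submatrix id J *ᵥ x) i := by
  rw [mulVec, mulVec, dotProduct, dotProduct]
  refine (Fintype.sum_of_injective J J.injective _ _ (fun l hl => ?_) fun j => ?_).symm
  · rw [extendZero_of_notMem J x hl, mul_zero]
  · rw [extendZero_apply]
    rfl

theorem sMinus_extendZero_add_one_le {k n : ℕ} (J : Fin k ↪o Fin n) {x : Fin k → ℝ}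
    (hx : x ≠ 0) : sMinus (extendZero J x) + 1 ≤ k := by
  have := sMinus_add_one_le_card (extendZero_ne_zero J hx) (Finset.univ.map J.toEmbedding)
    fun i hi => by
      by_contra hmem
      exact hi (extendZero_of_notMem J x fun ⟨j, hj⟩ =>
        hmem (Finset.mem_map.2 ⟨j, Finset.mem_univ _, hj⟩))
  simpa using this

theorem le_sPlus_of_zeros {m r : ℕ} {y : Fin m → ℝ} (I : Fin r ↪o Fin m)
    (h : ∀ i, y (I i) = 0) : r ≤ sPlus y := by
  by_cases hy : y = 0
  · have := Fintype.card_le_of_injective I I.injective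
    rw [hy, sPlus_zero]
    simpa using this
  · obtain ⟨l, hl⟩ := Function.ne_iff.1 hy
    have hmem : l ∉ Finset.univ.map I.toEmbedding := fun hmem => by
      obtain ⟨i, -, rfl⟩ := Finset.mem_map.1 hmem
      exact hl (h i)
    set t := insert l (Finset.univ.map I.toEmbedding) with ht
    have hcard : t.card = r + 1 := by
      rw [ht, Finset.card_insert_of_notMem hmem]
      simp
    set K := t.orderEmbOfFin hcard
    obtain ⟨p, hp⟩ : l ∈ Set.range K := by
      rw [Finset.range_orderEmbOfFin]
      simp [ht]
    -- Zeros fit any pattern, so only the phase at `l`, which has rank `p` in `t`, must be matched.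
    refine le_sPlus_of_alternating K (τ := SignType.sign (y l) * (-1) ^ (p : ℕ))
      (mul_ne_zero (by simpa using hl) (neg_one_pow_signType_ne_zero _)) fun k => ?_
    have hk : K k ∈ t := Finset.orderEmbOfFin_mem t hcard k
    rw [ht, Finset.mem_insert] at hk
    rcases hk with hk | hk
    · obtain rfl : k = p := K.injective (hk.trans hp.symm)
      rw [hk, mul_assoc, neg_one_pow_mul_self, mul_one]
      exact Or.inr rfl
    · obtain ⟨i, -, hi⟩ := Finset.mem_map.1 hk
      rw [← hi]
      exact Or.inl (h i)

/-- The variation diminishing property determines the signs of all minors. -/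
theorem VariationDiminishing.sign_det {m n : ℕ} {A : Matrix (Fin m) (Fin n) ℝ}
    {ε : Fin (min m n) → SignType} (hε : ∀ i, ε i = 1 ∨ ε i = -1)
    (h : VariationDiminishing A ε) (r : ℕ) (hr : r ≤ min m n) (I : Fin r ↪o Fin m)
    (J : Fin r ↪o Fin n) : SignType.sign (A.submatrix I J).det = signAt ε r := by
  induction r with
  | zero => simp [signAt_zero]
  | succ k ih =>
    set B := A.submatrix I J with hB
    have hAB : ∀ x i, (A *ᵥ extendZero J x) (I i) = (B *ᵥ x) i := fun x i =>
      mulVec_extendZero A J x (I i)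
    -- A kernel vector of `B`, extended by zero, has at most `k` sign changes, whereas its image has
    -- `k + 1` zeros and hence `S⁺ ≥ k + 1`.
    have hdet : B.det ≠ 0 := by
      intro h0
      obtain ⟨x, hx, hBx⟩ := exists_mulVec_eq_zero_iff.2 h0
      have h1 := le_sPlus_of_zeros (y := A *ᵥ extendZero J x) I fun i => by rw [hAB, hBx]; rfl
      have h2 := h.1 _ (extendZero_ne_zero J hx)
      have h3 := sMinus_extendZero_add_one_le J hx
      omega
    set v : Fin (k + 1) → ℝ := fun j => (-1) ^ (j : ℕ) with hv
    set x := B.adjugate *ᵥ v with hxdef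
    have hv0 : v ≠ 0 := fun h0 => by simpa [hv] using congrFun h0 0
    have hx0 : SignType.sign (x 0) = signAt ε k := by
      rw [hxdef, sign_adjugate_mulVec_zero B (η := signAt ε k) (σ := 1) (signAt_ne_zero hε k)
        (fun j => ih (by omega) ((Fin.succAboveOrderEmb j).trans I)
          ((Fin.succOrderEmb k).trans J))
        (fun j => Or.inr (by rw [one_mul]; exact sign_neg_one_pow _)) hv0, mul_one]
    have hx0' : x 0 ≠ 0 := by
      rw [← sign_ne_zero, hx0]
      exact signAt_ne_zero hε k
    have hx : x ≠ 0 := fun h0 => hx0' (by rw [h0]; rfl)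
    set y := A *ᵥ extendZero J x with hy
    have hyI : ∀ j, SignType.sign (y (I j)) = SignType.sign B.det * (-1) ^ (j : ℕ) := fun j => by
      rw [hy, hAB, hxdef, mulVec_mulVec, mul_adjugate, smul_mulVec, one_mulVec, Pi.smul_apply,
        smul_eq_mul, sign_mul, sign_neg_one_pow]
    have hδ : SignType.sign B.det ≠ 0 := by simpa using hdet
    have hyne : ∀ j, y (I j) ≠ 0 := fun j => by
      rw [← sign_ne_zero, hyI]
      exact mul_ne_zero hδ (neg_one_pow_signType_ne_zero _)
    have hy0 : y ≠ 0 := fun h0 => hyne 0 (by rw [h0]; rfl)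
    have h1 : k ≤ sPlus y := le_sPlus_of_alternating I hδ fun j => Or.inr (hyI j)
    have h2 : sPlus y ≤ _ := h.1 _ (extendZero_ne_zero J hx)
    have h3 := sMinus_extendZero_add_one_le J hx
    obtain ⟨s, hs, hsmax⟩ := isMaxFilling_exists hy0
    have hm : 0 < m := by omega
    have hyk : sPlus y = k := by omega
    have hend := (h.2 (extendZero J x) k hy0 hyk (by omega) (by omega) s ⟨hs, hsmax⟩).1
      ⟨0, hm⟩ (J 0) rfl ⟨by rwa [extendZero_apply], fun l hl => extendZero_of_notMem J x (by
        rintro ⟨j, rfl⟩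
        exact absurd (J.lt_iff_lt.1 hl) (Fin.not_lt_zero j))⟩
    rw [extendZero_apply, hx0, mul_right_comm,
      sign_mul_self_of_ne_zero (signAt_ne_zero hε k), one_mul] at hend
    -- The end condition concerns row `0`, the determinant row `I 0`. All `k` sign changes of `s`
    -- occur between `I 0` and the last row of `I`, so both rows lie in block `0` and have the same
    -- sign.
    obtain ⟨b, σ, -, hb, hle, hsb, -⟩ := exists_blocks s ⟨⟨0, hm⟩, hs.1 _⟩
    have hsI : ∀ j, s (I j) = SignType.sign B.det * (-1) ^ (j : ℕ) := fun j => by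
      rw [hs.2 _ (hyne j), hyI]
    have h4 := add_le_block_of_alternating hb hsb I hδ hsI (Fin.last k)
    have h5 := hle (I (Fin.last k))
    have h6 : b ⟨0, hm⟩ ≤ b (I 0) := hb (Fin.mk_le_of_le_val (Nat.zero_le _))
    rw [Fin.val_last] at h4
    have h7 := hsI 0
    rw [hsb _ (hs.1 _), show b (I 0) = 0 by omega, Fin.val_zero] at h7
    rw [hsb _ (hs.1 _), show b ⟨0, hm⟩ = 0 by omega] at hend
    rw [← hend, h7, pow_zero, mul_one]

/-! ### Test vectors of contiguous submatrices. -/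

theorem InAlternatingBiorthant.exists_sign {k : ℕ} {v : Fin k → ℝ}
    (hv : InAlternatingBiorthant v) :
    ∃ τ : SignType, τ ≠ 0 ∧ ∀ j, v j = 0 ∨ SignType.sign (v j) = τ * (-1) ^ (j : ℕ) := by
  have key : ∀ (τ : SignType) (j : Fin k), SignType.sign ((-1) ^ (j : ℕ) * v j) = τ →
      SignType.sign (v j) = τ * (-1) ^ (j : ℕ) := by
    rintro τ j rfl
    rw [sign_mul, sign_neg_one_pow, mul_right_comm, neg_one_pow_mul_self, one_mul]
  have hne : ∀ j, v j ≠ 0 → (-1) ^ (j : ℕ) * v j ≠ 0 := fun j hj =>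
    mul_ne_zero (pow_ne_zero _ (by norm_num)) hj
  rcases hv.2 with h | h
  · refine ⟨1, by decide, fun j => or_iff_not_imp_left.2 fun hj => key 1 j ?_⟩
    exact sign_pos (lt_of_le_of_ne (h j) (hne j hj).symm)
  · refine ⟨-1, by decide, fun j => or_iff_not_imp_left.2 fun hj => key (-1) j ?_⟩
    exact sign_neg (lt_of_le_of_ne (h j) (hne j hj))

/-- The order embedding onto the `k` consecutive indices that start at `a`. -/
def shiftEmb {k m : ℕ} (a : ℕ) (h : a + k ≤ m) : Fin k ↪o Fin m :=
  OrderEmbedding.ofStrictMono (fun i => ⟨a + i, by omega⟩) fun i j hij => by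
    exact Fin.lt_def.2 (Nat.add_lt_add_left (Fin.lt_def.1 hij) a)

theorem contiguous_submatrix {m n k r : ℕ} (A : Matrix (Fin m) (Fin n) ℝ) (a b : ℕ)
    (ha : a + k ≤ m) (hb : b + k ≤ n) (I J : Fin r ↪o Fin k) :
    (contiguous A k a b ha hb).submatrix I J =
      A.submatrix (I.trans (shiftEmb a ha)) (J.trans (shiftEmb b hb)) :=
  rfl

/-- The test vector of a contiguous submatrix determines the sign of its determinant. -/
theorem TestVectorCondition.sign_det_contiguous {m n : ℕ} {A : Matrix (Fin m) (Fin n) ℝ}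
    {ε : Fin (min m n) → SignType} (hε : ∀ i, ε i = 1 ∨ ε i = -1)
    {v : (k : ℕ) → ℕ → ℕ → Fin k → ℝ} (h : TestVectorCondition A ε v) {k a b : ℕ}
    (ha : a + (k + 1) ≤ m) (hb : b + (k + 1) ≤ n) (hv : InAlternatingBiorthant (v (k + 1) a b))
    (hA : ∀ (I : Fin k ↪o Fin m) (J : Fin k ↪o Fin n),
      SignType.sign (A.submatrix I J).det = signAt ε k) :
    SignType.sign (contiguous A (k + 1) a b ha hb).det = signAt ε (k + 1) := by
  obtain ⟨h1, h2⟩ := h (k + 1) a b ha hb (by omega)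
  obtain ⟨τ, hτ, hvτ⟩ := hv.exists_sign
  have hv0 := hv.1
  revert h1 h2 hvτ hv0
  generalize v (k + 1) a b = w
  intro h1 h2 hwτ hw0
  set B := contiguous A (k + 1) a b ha hb with hB
  set x := B.adjugate *ᵥ w with hx
  have h3 := sMinus_lt (by omega) x
  have hy : B *ᵥ x = B.det • w := by
    rw [hx, mulVec_mulVec, mul_adjugate, smul_mulVec, one_mulVec]
  -- The convention `S⁺(0) = k + 1` matters here: it exceeds any possible `S⁻(x)`, so the inequality
  -- alone gives `det B ≠ 0`.
  have hy0 : B *ᵥ x ≠ 0 := fun h0 => by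
    rw [h0, sPlus_zero] at h1
    omega
  have hδ : SignType.sign B.det ≠ 0 := sign_ne_zero.2 fun h0 => hy0 (by rw [hy, h0, zero_smul])
  have hyτ : ∀ j, (B *ᵥ x) j = 0 ∨
      SignType.sign ((B *ᵥ x) j) = SignType.sign B.det * τ * (-1) ^ (j : ℕ) := fun j => by
    rw [hy, Pi.smul_apply, smul_eq_mul]
    rcases hwτ j with hj | hj
    · exact Or.inl (by rw [hj, mul_zero])
    · exact Or.inr (by rw [sign_mul, hj, mul_assoc])
  -- The fully alternating filling has `k` changes, which forces `S⁺ = S⁻ = k` and makes this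
  -- filling maximal.
  set s : Fin (k + 1) → SignType := fun j => SignType.sign B.det * τ * (-1) ^ (j : ℕ) with hs
  have hδτ : SignType.sign B.det * τ ≠ 0 := mul_ne_zero hδ hτ
  have hfill : IsFilling (B *ᵥ x) s :=
    ⟨fun j => mul_ne_zero hδτ (neg_one_pow_signType_ne_zero _),
      fun j hj => ((hyτ j).resolve_left hj).symm⟩
  have h4 : k ≤ signChanges s :=
    le_signChanges_of_alternating (RelEmbedding.refl _) hδτ fun j => rfl
  have h5 := signChanges_le_sPlus hy0 hfill
  have hx0 : SignType.sign (x 0) = signAt ε k * τ :=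
    sign_adjugate_mulVec_zero B (signAt_ne_zero hε k)
      (fun j => hA ((Fin.succAboveOrderEmb j).trans (shiftEmb a ha))
        ((Fin.succOrderEmb k).trans (shiftEmb b hb))) hwτ hw0
  have hend := (h2 k (by omega) (by omega) (by omega) s ⟨hfill, by omega⟩).1 0 0 rfl
    ⟨by rw [← sign_ne_zero, hx0]; exact mul_ne_zero (signAt_ne_zero hε k) hτ,
      fun l hl => absurd hl (Fin.not_lt_zero l)⟩
  rw [hx0] at hend
  have hcalc : signAt ε k * signAt ε (k + 1) * (signAt ε k * τ) = signAt ε (k + 1) * τ := by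
    rw [← mul_assoc, mul_right_comm (signAt ε k), sign_mul_self_of_ne_zero (signAt_ne_zero hε k),
      one_mul]
  rw [hcalc] at hend
  simp only [hs, Fin.val_zero, pow_zero, mul_one] at hend
  exact mul_right_cancel₀ hτ hend

theorem TestVectorCondition.sign_det {m n : ℕ} {A : Matrix (Fin m) (Fin n) ℝ}
    {ε : Fin (min m n) → SignType} (hε : ∀ i, ε i = 1 ∨ ε i = -1)
    {v : (k : ℕ) → ℕ → ℕ → Fin k → ℝ}
    (hv : ∀ k a b : ℕ, 1 ≤ k → a + k ≤ m → b + k ≤ n → InAlternatingBiorthant (v k a b))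
    (h : TestVectorCondition A ε v) (r : ℕ) (I : Fin r ↪o Fin m)
    (J : Fin r ↪o Fin n) : SignType.sign (A.submatrix I J).det = signAt ε r := by
  induction r with
  | zero => simp [signAt_zero]
  | succ k ih =>
    exact sign_det_of_contiguous A (signAt_ne_zero hε k) ih
      (fun a b ha hb => h.sign_det_contiguous hε ha hb (hv _ _ _ (by omega) ha hb) ih) I J

theorem IsSSR.sign_det {m n : ℕ} {A : Matrix (Fin m) (Fin n) ℝ}
    {ε : Fin (min m n) → SignType} (h : IsSSR A ε) (r : ℕ) (hr : r ≤ min m n)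
    (I : Fin r ↪o Fin m) (J : Fin r ↪o Fin n) :
    SignType.sign (A.submatrix I J).det = signAt ε r := by
  rcases Nat.eq_zero_or_pos r with rfl | hpos
  · simp [signAt_zero]
  · exact h r hpos hr I J

theorem IsSSR.variationDiminishing {m n : ℕ} {A : Matrix (Fin m) (Fin n) ℝ}
    {ε : Fin (min m n) → SignType} (hε : ∀ i, ε i = 1 ∨ ε i = -1) (h : IsSSR A ε) :
    VariationDiminishing A ε := by
  have key := fun (x : Fin n → ℝ) (hx : x ≠ 0) =>
    variationDiminishing_of_minors A (signAt ε) (fun r _ => signAt_ne_zero hε r) h.sign_det hx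
  refine ⟨fun x hx => (key x hx).1, fun x r hy => (key x fun h0 => hy ?_).2 r⟩
  rw [h0, mulVec_zero]

/-- Minors of a contiguous submatrix are minors of `A`, so variation diminution applies to the
submatrix itself. The test vector is nonzero because its image is a nonzero multiple of `v k a b`.
-/
theorem IsSSR.testVectorCondition {m n : ℕ} {A : Matrix (Fin m) (Fin n) ℝ}
    {ε : Fin (min m n) → SignType} (hε : ∀ i, ε i = 1 ∨ ε i = -1)
    {v : (k : ℕ) → ℕ → ℕ → Fin k → ℝ}
    (hv : ∀ k a b : ℕ, 1 ≤ k → a + k ≤ m → b + k ≤ n → InAlternatingBiorthant (v k a b))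
    (h : IsSSR A ε) : TestVectorCondition A ε v := by
  intro k a b ha hb hk B x
  have hminors : ∀ r ≤ min k k, ∀ I J : Fin r ↪o Fin k,
      SignType.sign (B.submatrix I J).det = signAt ε r := fun r hr I J => by
    rw [contiguous_submatrix]
    exact h.sign_det r (by omega) _ _
  have hdet : B.det ≠ 0 := by
    have := hminors k (by simp) (RelEmbedding.refl _) (RelEmbedding.refl _)
    rw [← sign_ne_zero]
    exact this ▸ signAt_ne_zero hε k
  have hx : x ≠ 0 := fun h0 => by
    have hBx : B *ᵥ x = B.det • v k a b := by
      rw [mulVec_mulVec, mul_adjugate, smul_mulVec, one_mulVec]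
    rw [h0, mulVec_zero] at hBx
    exact smul_ne_zero hdet (hv k a b hk ha hb).1 hBx.symm
  have key := variationDiminishing_of_minors B (signAt ε) (fun r _ => signAt_ne_zero hε r)
    hminors hx
  exact ⟨key.1, fun r h1 h2 h3 => key.2 r h1 h2 (by simpa using h3)⟩

end SignRegular

theorem theoremB (m n : ℕ) (hm : 1 ≤ m) (hn : 1 ≤ n) (A : Matrix (Fin m) (Fin n) ℝ)
    (ε : Fin (min m n) → SignType) (hε : ∀ i, ε i = 1 ∨ ε i = -1)
    (v : (k : ℕ) → ℕ → ℕ → Fin k → ℝ)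
    (hv : ∀ k a b : ℕ, 1 ≤ k → a + k ≤ m → b + k ≤ n →
      SignRegular.InAlternatingBiorthant (v k a b)) :
    List.TFAE [
      SignRegular.IsSSR A ε,
      SignRegular.VariationDiminishing A ε,
      SignRegular.TestVectorCondition A ε v] := by
  tfae_have 1 → 2 := fun h => h.variationDiminishing hε
  tfae_have 2 → 1 := fun h r _ hr => h.sign_det hε r hr
  tfae_have 1 → 3 := fun h => h.testVectorCondition hε hv
  tfae_have 3 → 1 := fun h r _ _ => h.sign_det hε hv r
  tfae_finish
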